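/- **Setting.** Let $\nu$ be a $\sigma$-finite reference measure on $\mathbb{R}$ (for instance Lebesgue measure, or the counting measure on $\mathbb{N}$), and let $\mu$ be a probability measure on $\mathbb{R}$ with density $m$ with respect to $\nu$. Let $\{Q_i ; i=0,1,\dots\}$ be an orthogonal basis of $L^2(\mu)$: nonzero, pairwise orthogonal functions with dense linear span. Let $Y$ and $Z$ be independent real random variables. Assume the null hypothesis $H_0$: $Y$ has the given density $f_0$ with respect to $\nu$, while $Z$ has the known density $g$ with respect to $\nu$. Assume that $Y+Z$ has a density $h$ with respect to $\nu$, that the laws of $Y$ and $Y+Z$ are dominated by $\mu$, and that $h\in L^2(\mu)$. Let $X_1,X_2,\dots$ be i.i.d. copies of $Y+Z$. For $j\ge 1$ assume that $Q_j(Y+Z)\,m(Y+Z)$ has a finite second moment. Put $\alpha_j=\mathbb{E}\big(Q_j(Y+Z)\,m(Y+Z)\big)$ and $$\hat b_j=\frac1{\sqrt n}\sum_{i=1}^n\big(Q_j(X_i)\,m(X_i)-\alpha_j\big),\qquad B_k=(\hat b_1,\dots,\hat b_k)^T,\qquad \Sigma_k=\operatorname{Var}(B_k),$$ where $\Sigma_k$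 is the $k\times k$ covariance matrix of $B_k$ (it does not depend on the sample size $n\ge1$), assumed invertible for every $k\ge 1$. Let $$T_k=\big\|\Sigma_k^{-1/2}B_k\big\|^2,$$ with the Euclidean norm. Let $k(n)$ be a nondecreasing sequence of natural numbers with $k(n)\to\infty$, and let $$S_n=\min\Big\{\operatorname*{argmax}_{1\le k\le k(n)}\big(T_k-k\log n\big)\Big\}.$$ **Proposition 2.1.** Let $\lambda_{k(n)}$ be the smallest eigenvalue of $\Sigma_{k(n)}$, and assume that $$\frac{\log k(n)}{\lambda_{k(n)}}=o(\log n)\qquad(n\to\infty).$$ Then, under $H_0$, $T_{S_n}$ converges in distribution, as $n\to\infty$, to a chi-squared random variable with $1$ degree of freedom. -/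

import Mathlib

open MeasureTheory ProbabilityTheory Filter Asymptotics

noncomputable section

namespace Deconvolution

/-- `f` is a (real, nonnegative, measurable) density of the measure `ρ` with respect to `ν`. -/
structure IsDensity (ρ ν : Measure ℝ) (f : ℝ → ℝ) : Prop where
  measurable : Measurable f
  nonneg : ∀ x, 0 ≤ f x
  eq_withDensity : ρ = ν.withDensity (fun x => ENNReal.ofReal (f x))

/-- `Q 0, Q 1, …` is an orthogonal basis of `L²(μ)`: square integrable nonzero functions,
pairwise orthogonal, whose linear span is dense in `L²(μ)`. They need not be normalized. -/
structure IsOrthogonalBasis (μ : Measure ℝ) (Q : ℕ → ℝ → ℝ) : Prop where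
  measurable : ∀ i, Measurable (Q i)
  memLp : ∀ i, MemLp (Q i) 2 μ
  orthogonal : ∀ i j, i ≠ j → ∫ x, Q i x * Q j x ∂μ = 0
  ne_zero : ∀ i, ∫ x, Q i x ^ 2 ∂μ ≠ 0
  dense : (Submodule.span ℝ
    (Set.range fun i => (memLp i).toLp (Q i))).topologicalClosure = ⊤

/-- The null coefficients `α_j = E (Q_j(Y + Z) m(Y + Z))`. -/
def nullCoeff {Ω' : Type*} [MeasurableSpace Ω'] (P' : Measure Ω') (Y Z : Ω' → ℝ)
    (Q : ℕ → ℝ → ℝ) (m : ℝ → ℝ) (j : ℕ) : ℝ :=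
  ∫ ω, Q j (Y ω + Z ω) * m (Y ω + Z ω) ∂P'

section Statistic

variable {Ω : Type*} [MeasurableSpace Ω]

/-- The centered empirical coefficient
`b̂_j = n^{-1/2} ∑_{i=1}^n (Q_j(X_i) m(X_i) - α_j)` of the sample `X 0, …, X (n - 1)`. -/
def empCoeff (Q : ℕ → ℝ → ℝ) (m : ℝ → ℝ) (α : ℕ → ℝ) (X : ℕ → Ω → ℝ) (n j : ℕ) (ω : Ω) : ℝ :=
  (1 / √(n : ℝ)) * ∑ i ∈ Finset.range n, (Q j (X i ω) * m (X i ω) - α j)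

/-- The vector `B_k = (b̂_1, …, b̂_k)` for sample size `n`; the entry with index `i : Fin k`
is `b̂_{i+1}`. -/
def coeffVec (Q : ℕ → ℝ → ℝ) (m : ℝ → ℝ) (α : ℕ → ℝ) (X : ℕ → Ω → ℝ) (n k : ℕ) (ω : Ω) :
    Fin k → ℝ :=
  fun i => empCoeff Q m α X n (i + 1) ω

/-- The covariance matrix `Σ_k = Var (B_k)` for sample size `n`. -/
def covMatrix (P : Measure Ω) (Q : ℕ → ℝ → ℝ) (m : ℝ → ℝ) (α : ℕ → ℝ) (X : ℕ → Ω → ℝ)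
    (n k : ℕ) : Matrix (Fin k) (Fin k) ℝ :=
  Matrix.of fun i j =>
    cov[fun ω => coeffVec Q m α X n k ω i, fun ω => coeffVec Q m α X n k ω j; P]

/-- The smallest eigenvalue of a real symmetric matrix: the least element of its (finite, real)
spectrum. -/
def smallestEigenvalue {k : ℕ} (A : Matrix (Fin k) (Fin k) ℝ) : ℝ :=
  sInf (spectrum ℝ A)

/-- `A^{-1/2}` for a symmetric positive definite matrix, by the spectral calculus:
`x ↦ x^{-1/2}` is applied to the eigenvalues of `A`. -/
def invSqrt {k : ℕ} (A : Matrix (Fin k) (Fin k) ℝ) : Matrix (Fin k) (Fin k) ℝ :=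
  cfc (fun x : ℝ => (√x)⁻¹) A

/-- `T_k = ‖U_k‖²` with `U_k = Σ_k^{-1/2} B_k` and the Euclidean norm, for sample size `n`. -/
def testStat (P : Measure Ω) (Q : ℕ → ℝ → ℝ) (m : ℝ → ℝ) (α : ℕ → ℝ) (X : ℕ → Ω → ℝ)
    (n k : ℕ) (ω : Ω) : ℝ :=
  ‖WithLp.toLp 2 ((invSqrt (covMatrix P Q m α X n k)).mulVec (coeffVec Q m α X n k ω))‖ ^ 2

/-- The Schwarz-type selection rule
`S_n = min argmax_{1 ≤ k ≤ K} (T_k - k log n)`, where `T` is a sequence of real numbers. -/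
def schwarzRule (T : ℕ → ℝ) (n K : ℕ) : ℕ :=
  sInf {k | k ∈ Finset.Icc 1 K ∧
    ∀ j ∈ Finset.Icc 1 K, T j - j * Real.log n ≤ T k - k * Real.log n}

/-- The data-driven statistic `T_{S_n}`, with `S_n` selected among `1, …, K n`. -/
def dataDrivenStat (P : Measure Ω) (Q : ℕ → ℝ → ℝ) (m : ℝ → ℝ) (α : ℕ → ℝ) (X : ℕ → Ω → ℝ)
    (K : ℕ → ℕ) (n : ℕ) (ω : Ω) : ℝ :=
  testStat P Q m α X n (schwarzRule (fun k => testStat P Q m α X n k ω) n (K n)) ω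

end Statistic

/-- The chi-squared distribution with `d` degrees of freedom: the law of the sum of the squares
of `d` independent standard normal variables. -/
def chiSquared (d : ℕ) : Measure ℝ :=
  (Measure.pi fun _ : Fin d => gaussianReal 0 1).map fun z => ∑ i, z i ^ 2

instance (d : ℕ) : IsProbabilityMeasure (chiSquared d) :=
  Measure.isProbabilityMeasure_map
    (Finset.measurable_sum _ fun i _ => (measurable_pi_apply i).pow_const 2).aemeasurable

end Deconvolution

end

noncomputable section

namespace Deconvolution

open scoped Matrix Topology

/-! ### Inverse square roots and quadratic forms of positive definite matrices -/

section Matrices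

variable {k : ℕ} {A : Matrix (Fin k) (Fin k) ℝ}

/-! With high probability the penalty forces `S_n = 1`, and `T_1` is the square of a standardized
i.i.d. sum, so the central limit theorem gives the chi-squared limit.

Two facts control the selection. `T_k` is nondecreasing in `k`, being the maximum over `v` of `2⟨v,
B_k⟩ - ⟨v, Σ_k v⟩` (`norm_invSqrt_mulVec_mono`). Also `E T_k = k`, since `Σ_k^{-1/2} B_k` has
identity covariance (`integral_norm_invSqrt_mulVec_sq`). If `S_n = s ≥ 2`, then `T_s ≥ (s - 1) log
n`. Rounding `s` up to a power of two leaves only about `log K(n)` events; Markov's inequality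
bounds each by `4 / log n`, whereas a union over all `s ≤ K(n)` would cost a factor `K(n)`.

The eigenvalue hypothesis enters only through `log K(n) = o(log n)`: the smallest eigenvalue is at
most the first diagonal entry of the covariance matrix, which is a constant. -/

lemma isHermitian_invSqrt (A : Matrix (Fin k) (Fin k) ℝ) : (invSqrt A).IsHermitian :=
  cfc_predicate (p := IsSelfAdjoint) (fun x : ℝ => (√x)⁻¹) A

lemma transpose_invSqrt (A : Matrix (Fin k) (Fin k) ℝ) : (invSqrt A)ᵀ = invSqrt A := by
  simpa [Matrix.IsHermitian] using isHermitian_invSqrt A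

lemma spectrum_pos_of_posDef (hA : A.PosDef) {x : ℝ} (hx : x ∈ spectrum ℝ A) : 0 < x := by
  rw [hA.isHermitian.spectrum_real_eq_range_eigenvalues] at hx
  obtain ⟨i, rfl⟩ := hx
  exact hA.eigenvalues_pos i

lemma spectrum_finite_of_posDef (hA : A.PosDef) : (spectrum ℝ A).Finite := by
  rw [hA.isHermitian.spectrum_real_eq_range_eigenvalues]
  exact Set.finite_range _

lemma invSqrt_mul_mul_invSqrt (hA : A.PosDef) : invSqrt A * A * invSqrt A = 1 := by
  have hfin := spectrum_finite_of_posDef hA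
  have hsa : IsSelfAdjoint A := hA.isHermitian
  have h1 : cfc (fun x : ℝ => (√x)⁻¹ * x * (√x)⁻¹) A = invSqrt A * A * invSqrt A := by
    rw [cfc_mul (fun x : ℝ => (√x)⁻¹ * x) (fun x : ℝ => (√x)⁻¹) A (hfin.continuousOn _)
      (hfin.continuousOn _), cfc_mul (fun x : ℝ => (√x)⁻¹) (fun x => x) A (hfin.continuousOn _)
      (hfin.continuousOn _), cfc_id' ℝ A hsa, invSqrt]
  rw [← h1, ← cfc_const_one ℝ A hsa]
  refine cfc_congr fun x hx => ?_
  have hx0 := spectrum_pos_of_posDef hA hx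
  have hs : √x ≠ 0 := (Real.sqrt_pos.2 hx0).ne'
  have := Real.mul_self_sqrt hx0.le
  field_simp
  nlinarith

lemma norm_toLp_sq (u : Fin k → ℝ) : ‖WithLp.toLp 2 u‖ ^ 2 = u ⬝ᵥ u := by
  rw [EuclideanSpace.real_norm_sq_eq]
  simp [dotProduct, sq]

lemma invSqrt_mulVec_dotProduct (w b : Fin k → ℝ) :
    (invSqrt A *ᵥ w) ⬝ᵥ b = w ⬝ᵥ (invSqrt A *ᵥ b) := by
  rw [Matrix.dotProduct_mulVec, ← Matrix.mulVec_transpose, transpose_invSqrt]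

lemma two_mul_invSqrt_mulVec_dotProduct_sub (hA : A.PosDef) (b w : Fin k → ℝ) :
    2 * ((invSqrt A *ᵥ w) ⬝ᵥ b) - (invSqrt A *ᵥ w) ⬝ᵥ (A *ᵥ (invSqrt A *ᵥ w)) =
      2 * (w ⬝ᵥ (invSqrt A *ᵥ b)) - w ⬝ᵥ w := by
  rw [invSqrt_mulVec_dotProduct, invSqrt_mulVec_dotProduct, Matrix.mulVec_mulVec,
    Matrix.mulVec_mulVec, invSqrt_mul_mul_invSqrt hA, Matrix.one_mulVec]

/-- `‖A^{-1/2} b‖²` is an upper bound of `2 ⟨v, b⟩ - ⟨v, A v⟩` over all `v`. -/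
lemma two_mul_dotProduct_sub_le (hA : A.PosDef) (b v : Fin k → ℝ) :
    2 * (v ⬝ᵥ b) - v ⬝ᵥ (A *ᵥ v) ≤ ‖WithLp.toLp 2 (invSqrt A *ᵥ b)‖ ^ 2 := by
  -- Every `v` has the form `A^{-1/2} w`; in terms of `w` the bound is completion of the square.
  have hv : v = invSqrt A *ᵥ ((invSqrt A * A) *ᵥ v) := by
    rw [Matrix.mulVec_mulVec, mul_eq_one_comm.1 (invSqrt_mul_mul_invSqrt hA),
      Matrix.one_mulVec]
  rw [hv, two_mul_invSqrt_mulVec_dotProduct_sub hA, norm_toLp_sq]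
  generalize (invSqrt A * A) *ᵥ v = w
  generalize invSqrt A *ᵥ b = u
  have h : 0 ≤ (w - u) ⬝ᵥ (w - u) := by
    simpa using dotProduct_star_self_nonneg (w - u)
  simp only [sub_dotProduct, dotProduct_sub] at h
  rw [dotProduct_comm u w] at h
  linarith

/-- `‖A^{-1/2} b‖²` is attained by `2 ⟨v, b⟩ - ⟨v, A v⟩`. -/
lemma exists_two_mul_dotProduct_sub_eq (hA : A.PosDef) (b : Fin k → ℝ) :
    ∃ v, 2 * (v ⬝ᵥ b) - v ⬝ᵥ (A *ᵥ v) = ‖WithLp.toLp 2 (invSqrt A *ᵥ b)‖ ^ 2 := by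
  refine ⟨invSqrt A *ᵥ (invSqrt A *ᵥ b), ?_⟩
  rw [two_mul_invSqrt_mulVec_dotProduct_sub hA, norm_toLp_sq]
  ring

/-- `‖A^{-1/2} b‖²` increases when a leading block is replaced by the whole matrix. -/
lemma norm_invSqrt_mulVec_mono {l : ℕ} (hkl : k ≤ l) {A' : Matrix (Fin l) (Fin l) ℝ}
    (hA : A.PosDef) (hA' : A'.PosDef) {b : Fin k → ℝ} {b' : Fin l → ℝ}
    (hAA' : ∀ i j, A' (Fin.castLE hkl i) (Fin.castLE hkl j) = A i j)
    (hbb' : ∀ i, b' (Fin.castLE hkl i) = b i) :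
    ‖WithLp.toLp 2 (invSqrt A *ᵥ b)‖ ^ 2 ≤ ‖WithLp.toLp 2 (invSqrt A' *ᵥ b')‖ ^ 2 := by
  obtain ⟨v, hv⟩ := exists_two_mul_dotProduct_sub_eq hA b
  have hinj := Fin.castLE_injective hkl
  -- Padding the maximizer with zeros keeps both terms of the functional, so the larger maximum
  -- dominates.
  set v' : Fin l → ℝ := Function.extend (Fin.castLE hkl) v 0 with hv'
  have hon : ∀ i, v' (Fin.castLE hkl i) = v i := fun i => hinj.extend_apply v 0 i
  have hoff : ∀ j ∉ Set.range (Fin.castLE hkl), v' j = 0 := fun j hj =>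
    Function.extend_apply' v (0 : Fin l → ℝ) j hj
  have hdot : ∀ (c : Fin k → ℝ) (c' : Fin l → ℝ), (∀ i, c' (Fin.castLE hkl i) = c i) →
      v' ⬝ᵥ c' = v ⬝ᵥ c := fun c c' hc =>
    (Fintype.sum_of_injective _ hinj _ _ (fun j hj => by simp [hoff j hj])
      fun i => by simp [hon, hc]).symm
  rw [← hv, ← hdot b b' hbb', ← hdot (A *ᵥ v) (A' *ᵥ v') fun i => ?_]
  · exact two_mul_dotProduct_sub_le hA' b' v'
  · simp only [Matrix.mulVec]
    rw [dotProduct_comm, hdot (A i) _ (hAA' i), dotProduct_comm]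

lemma smallestEigenvalue_pos (hA : A.PosDef) (hk : 1 ≤ k) : 0 < smallestEigenvalue A := by
  have hne : (spectrum ℝ A).Nonempty := by
    rw [hA.isHermitian.spectrum_real_eq_range_eigenvalues]
    have : Nonempty (Fin k) := ⟨⟨0, hk⟩⟩
    exact Set.range_nonempty _
  exact spectrum_pos_of_posDef hA (hne.csInf_mem (spectrum_finite_of_posDef hA))

/-- Subtracting the smallest eigenvalue times the identity leaves a positive semidefinite matrix,
whose diagonal is nonnegative. -/
lemma smallestEigenvalue_le_diag (hA : A.PosDef) (i : Fin k) : smallestEigenvalue A ≤ A i i := by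
  have hB : (A - algebraMap ℝ _ (smallestEigenvalue A)).PosSemidef := by
    rw [Matrix.posSemidef_iff_isHermitian_and_spectrum_nonneg]
    refine ⟨hA.isHermitian.sub ?_, ?_⟩
    · simp [Matrix.IsHermitian, Matrix.algebraMap_eq_diagonal]
    · rw [← spectrum.sub_singleton_eq]
      rintro _ ⟨x, hx, _, rfl, rfl⟩
      exact sub_nonneg.2 (csInf_le (spectrum_finite_of_posDef hA).bddBelow hx)
  have := hB.diag_nonneg (i := i)
  simpa [Matrix.algebraMap_eq_diagonal] using this

end Matrices

/-! ### Second moments of centered random vectors -/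

section Covariance

variable {Ω : Type*} [MeasurableSpace Ω] {P : Measure Ω}
  {k : ℕ} {V : Ω → Fin k → ℝ}

lemma memLp_dotProduct (hV : ∀ i, MemLp (fun ω => V ω i) 2 P) (x : Fin k → ℝ) :
    MemLp (fun ω => x ⬝ᵥ V ω) 2 P :=
  memLp_finsetSum _ fun i _ => (hV i).const_mul (x i)

lemma integrable_norm_mulVec_sq (hV : ∀ i, MemLp (fun ω => V ω i) 2 P)
    (R : Matrix (Fin k) (Fin k) ℝ) :
    Integrable (fun ω => ‖WithLp.toLp 2 (R *ᵥ V ω)‖ ^ 2) P := by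
  simp only [EuclideanSpace.real_norm_sq_eq]
  exact integrable_finsetSum _ fun i _ => (memLp_dotProduct hV (R i)).integrable_sq

variable [IsProbabilityMeasure P]

lemma integral_sq_dotProduct (hV : ∀ i, MemLp (fun ω => V ω i) 2 P)
    (hV0 : ∀ i, ∫ ω, V ω i ∂P = 0) (x : Fin k → ℝ) :
    ∫ ω, (x ⬝ᵥ V ω) ^ 2 ∂P =
      x ⬝ᵥ ((Matrix.of fun i j => cov[fun ω => V ω i, fun ω => V ω j; P]) *ᵥ x) := by
  have hm : AEMeasurable (fun ω => x ⬝ᵥ V ω) P :=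
    (memLp_dotProduct hV x).aestronglyMeasurable.aemeasurable
  have h0 : ∫ ω, x ⬝ᵥ V ω ∂P = 0 := by
    simp only [dotProduct]
    rw [integral_finsetSum _ fun i _ => ((hV i).integrable (by norm_num)).const_mul (x i)]
    simp [integral_const_mul, hV0]
  rw [← variance_of_integral_eq_zero hm h0, ← covariance_self hm]
  simp only [dotProduct, Matrix.mulVec, Matrix.of_apply]
  rw [covariance_fun_sum_fun_sum (fun i => (hV i).const_mul (x i))
    (fun i => (hV i).const_mul (x i))]
  simp only [covariance_const_mul_left, covariance_const_mul_right, Finset.mul_sum]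
  exact Finset.sum_congr rfl fun i _ => Finset.sum_congr rfl fun j _ => by ring

lemma posSemidef_cov (hV : ∀ i, MemLp (fun ω => V ω i) 2 P)
    (hV0 : ∀ i, ∫ ω, V ω i ∂P = 0) :
    (Matrix.of fun i j => cov[fun ω => V ω i, fun ω => V ω j; P]).PosSemidef := by
  rw [Matrix.posSemidef_iff_dotProduct_mulVec]
  refine ⟨Matrix.ext fun i j => ?_, fun x => ?_⟩
  · simp [covariance_comm]
  · rw [star_trivial, ← integral_sq_dotProduct hV hV0]
    exact integral_nonneg fun ω => sq_nonneg _

/-- A standardized centered random vector of dimension `k` has `E ‖U‖² = k`. -/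
lemma integral_norm_invSqrt_mulVec_sq (hV : ∀ i, MemLp (fun ω => V ω i) 2 P)
    (hV0 : ∀ i, ∫ ω, V ω i ∂P = 0) {C : Matrix (Fin k) (Fin k) ℝ}
    (hC : C = Matrix.of fun i j => cov[fun ω => V ω i, fun ω => V ω j; P]) (hpd : C.PosDef) :
    ∫ ω, ‖WithLp.toLp 2 (invSqrt C *ᵥ V ω)‖ ^ 2 ∂P = k := by
  simp only [EuclideanSpace.real_norm_sq_eq]
  rw [integral_finsetSum (f := fun i ω => ((invSqrt C *ᵥ V ω) i) ^ 2) _ fun i _ =>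
    (memLp_dotProduct hV (invSqrt C i)).integrable_sq]
  -- Each coordinate's second moment is a diagonal entry of `C^{-1/2} C C^{-1/2} = 1`.
  have key : ∀ i, ∫ ω, ((invSqrt C *ᵥ V ω) i) ^ 2 ∂P = 1 := by
    intro i
    have h1 := integral_sq_dotProduct hV hV0 (invSqrt C i)
    rw [← hC] at h1
    have h2 : (invSqrt C * C * invSqrt C) i i = 1 := by
      rw [invSqrt_mul_mul_invSqrt hpd, Matrix.one_apply_eq]
    rw [mul_assoc, Matrix.mul_apply] at h2
    refine h1.trans (Eq.trans ?_ h2)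
    refine Finset.sum_congr rfl fun j _ => ?_
    congr 1
    rw [Matrix.mul_apply]
    change ∑ l, C j l * invSqrt C i l = _
    refine Finset.sum_congr rfl fun l _ => ?_
    congr 1
    exact (isHermitian_invSqrt C).apply l i
  simp [key]

end Covariance

/-! ### The selection rule, for a deterministic sequence -/

section Selection

lemma schwarzRule_mem {T : ℕ → ℝ} {n N : ℕ} (hN : 1 ≤ N) :
    schwarzRule T n N ∈ Finset.Icc 1 N ∧
      ∀ j ∈ Finset.Icc 1 N,
        T j - j * Real.log n ≤ T (schwarzRule T n N) - schwarzRule T n N * Real.log n := by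
  obtain ⟨k, hk, hmax⟩ := (Finset.Icc 1 N).exists_max_image (fun j => T j - j * Real.log n)
    ⟨1, by simp [hN]⟩
  exact Nat.sInf_mem (s := {k | k ∈ Finset.Icc 1 N ∧
    ∀ j ∈ Finset.Icc 1 N, T j - j * Real.log n ≤ T k - k * Real.log n}) ⟨k, hk, hmax⟩

/-- If the rule does not select dimension `1`, then a nonnegative increasing `T` is large at
some power of two. -/
lemma exists_le_of_schwarzRule_ne_one {T : ℕ → ℝ} {n N : ℕ} (hN : 1 ≤ N)
    (hT : 0 ≤ T 1) (hmono : ∀ k l, 1 ≤ k → k ≤ l → T k ≤ T l) (hS : schwarzRule T n N ≠ 1) :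
    ∃ r ∈ Finset.Icc 1 (Nat.log 2 N), (2 : ℝ) ^ r / 2 * Real.log n ≤ T (2 ^ (r + 1)) := by
  obtain ⟨hmem, hmax⟩ := schwarzRule_mem (T := T) (n := n) hN
  generalize schwarzRule T n N = s at *
  rw [Finset.mem_Icc] at hmem
  have hs2 : 2 ≤ s := by omega
  have hlog : 0 ≤ Real.log n := Real.log_natCast_nonneg n
  have h1 := hmax 1 (by simp [hN])
  refine ⟨Nat.log 2 s, Finset.mem_Icc.2 ⟨?_, Nat.log_mono_right hmem.2⟩, ?_⟩
  · exact Nat.log_pos (by norm_num) hs2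
  · have hle : (2 : ℝ) ^ Nat.log 2 s ≤ s := by
      exact_mod_cast Nat.pow_log_le_self 2 (by omega)
    have hlt : s ≤ 2 ^ (Nat.log 2 s + 1) := (Nat.lt_pow_succ_log_self (by norm_num) s).le
    refine le_trans ?_ (hmono s _ hmem.1 hlt)
    have hs2' : (2 : ℝ) ≤ s := by exact_mod_cast hs2
    -- Since `s ≥ 2`, `2 ^ r / 2 ≤ s / 2 ≤ s - 1`.
    have : (2 : ℝ) ^ Nat.log 2 s / 2 * Real.log n ≤ (s - 1) * Real.log n :=
      mul_le_mul_of_nonneg_right (by linarith) hlog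
    push_cast at h1
    linarith

lemma measurable_apply_schwarzRule (n N : ℕ) :
    Measurable fun T : ℕ → ℝ => T (schwarzRule T n N) := by
  have hset : ∀ k, MeasurableSet {T : ℕ → ℝ | k ∈ Finset.Icc 1 N ∧
      ∀ j ∈ Finset.Icc 1 N, T j - j * Real.log n ≤ T k - k * Real.log n} := fun k => by
    refine (MeasurableSet.const _).inter ?_
    have : {T : ℕ → ℝ | ∀ j ∈ Finset.Icc 1 N, T j - j * Real.log n ≤ T k - k * Real.log n} =
        ⋂ j ∈ Finset.Icc 1 N, {T : ℕ → ℝ | T j - j * Real.log n ≤ T k - k * Real.log n} := by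
      ext; simp
    change MeasurableSet {T : ℕ → ℝ | ∀ j ∈ Finset.Icc 1 N, _}
    rw [this]
    exact Finset.measurableSet_biInter _ fun j _ =>
      measurableSet_le (by fun_prop) (by fun_prop)
  have hS : Measurable fun T : ℕ → ℝ => schwarzRule T n N := by
    -- For `N = 0` there is no candidate, and the rule is constantly `sInf ∅ = 0`.
    rcases Nat.eq_zero_or_pos N with rfl | hN
    · simp [schwarzRule]
    classical
    have hex : ∀ T : ℕ → ℝ, ∃ k, k ∈ Finset.Icc 1 N ∧
      ∀ j ∈ Finset.Icc 1 N, T j - j * Real.log n ≤ T k - k * Real.log n :=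
      fun T => ⟨_, schwarzRule_mem hN⟩
    have : (fun T : ℕ → ℝ => schwarzRule T n N) = fun T => Nat.find (hex T) := by
      funext T
      refine (Nat.sInf_def (hex T)).trans ?_
      congr!
    rw [this]
    exact measurable_find hex hset
  exact (measurable_from_prod_countable_right (f := fun p : ℕ × (ℕ → ℝ) => p.2 p.1)
    fun k => measurable_pi_apply k).comp (hS.prodMk measurable_id)

end Selection

lemma map_sq_gaussianReal : (gaussianReal 0 1).map (fun x => x ^ 2) = chiSquared 1 := by
  have h := (measurePreserving_eval (fun _ : Fin 1 => gaussianReal 0 1) 0).map_eq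
  rw [← h, Measure.map_map (by fun_prop) (by fun_prop), chiSquared]
  congr 1
  funext z
  simp

/-! ### The test statistics of an i.i.d. sample -/

section Sample

variable {Ω : Type*} [MeasurableSpace Ω] {P : Measure Ω}
  {Q : ℕ → ℝ → ℝ} {m : ℝ → ℝ} {α : ℕ → ℝ} {X : ℕ → Ω → ℝ} {n j : ℕ}

lemma aemeasurable_empCoeff (hQ : ∀ j, Measurable (Q j)) (hm : Measurable m)
    (hX : ∀ i, AEMeasurable (X i) P) (n j : ℕ) : AEMeasurable (empCoeff Q m α X n j) P :=
  (Finset.aemeasurable_fun_sum _ fun i _ => (((hQ j).comp_aemeasurable (hX i)).mul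
    (hm.comp_aemeasurable (hX i))).sub_const _).const_mul _

lemma aemeasurable_testStat (hQ : ∀ j, Measurable (Q j)) (hm : Measurable m)
    (hX : ∀ i, AEMeasurable (X i) P) (n k : ℕ) : AEMeasurable (testStat P Q m α X n k) P := by
  unfold testStat
  simp only [EuclideanSpace.real_norm_sq_eq]
  have hb : ∀ l : Fin k, AEMeasurable (fun ω => coeffVec Q m α X n k ω l) P :=
    fun l => aemeasurable_empCoeff hQ hm hX n (l + 1)
  generalize invSqrt (covMatrix P Q m α X n k) = R
  simp only [Matrix.mulVec, dotProduct]
  exact Finset.aemeasurable_fun_sum _ fun i _ => AEMeasurable.pow_const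
    (Finset.aemeasurable_fun_sum _ fun l _ => (hb l).const_mul (R i l)) 2

lemma aemeasurable_dataDrivenStat (hQ : ∀ j, Measurable (Q j)) (hm : Measurable m)
    (hX : ∀ i, AEMeasurable (X i) P) (K : ℕ → ℕ) (n : ℕ) :
    AEMeasurable (dataDrivenStat P Q m α X K n) P :=
  (measurable_apply_schwarzRule n (K n)).comp_aemeasurable
    (f := fun ω k => testStat P Q m α X n k ω)
    (aemeasurable_pi_lambda _ fun k => aemeasurable_testStat hQ hm hX n k)

lemma covMatrix_eq (n k : ℕ) : covMatrix P Q m α X n k = Matrix.of fun i j =>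
    cov[fun ω => coeffVec Q m α X n k ω i, fun ω => coeffVec Q m α X n k ω j; P] := rfl

lemma testStat_nonneg (n k : ℕ) (ω : Ω) : 0 ≤ testStat P Q m α X n k ω := sq_nonneg _

lemma testStat_mono {k l : ℕ} (hkl : k ≤ l) (hk : (covMatrix P Q m α X n k).PosDef)
    (hl : (covMatrix P Q m α X n l).PosDef) (ω : Ω) :
    testStat P Q m α X n k ω ≤ testStat P Q m α X n l ω :=
  norm_invSqrt_mulVec_mono hkl hk hl (fun _ _ => rfl) fun _ => rfl

variable [IsProbabilityMeasure P]

lemma memLp_empCoeff (hW : ∀ i, MemLp (fun ω => Q j (X i ω) * m (X i ω)) 2 P) (n : ℕ) :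
    MemLp (empCoeff Q m α X n j) 2 P :=
  (memLp_finsetSum _ fun i _ => (hW i).sub (memLp_const _)).const_mul _

lemma integral_empCoeff (hW : ∀ i, MemLp (fun ω => Q j (X i ω) * m (X i ω)) 2 P)
    (hα : ∀ i, ∫ ω, Q j (X i ω) * m (X i ω) ∂P = α j) (n : ℕ) :
    ∫ ω, empCoeff Q m α X n j ω ∂P = 0 := by
  have hint : ∀ i, Integrable (fun ω => Q j (X i ω) * m (X i ω)) P :=
    fun i => (hW i).integrable (by norm_num)
  simp only [empCoeff]
  rw [integral_const_mul, integral_finsetSum (f := fun i ω => Q j (X i ω) * m (X i ω) - α j) _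
    fun i _ => (hint i).sub (integrable_const _)]
  simp [integral_sub (hint _) (integrable_const _), hα]

/-- The variance of an empirical coefficient does not depend on the sample size. -/
lemma variance_empCoeff (hQ : Measurable (Q j)) (hm : Measurable m) (hindep : iIndepFun X P)
    (hident : ∀ i, IdentDistrib (X i) (X 0) P P)
    (hW : ∀ i, MemLp (fun ω => Q j (X i ω) * m (X i ω)) 2 P) (hn : 1 ≤ n) :
    Var[empCoeff Q m α X n j; P] = Var[fun ω => Q j (X 0 ω) * m (X 0 ω); P] := by
  have hu : Measurable fun x => Q j x * m x - α j := (hQ.mul hm).sub_const _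
  have hvar : ∀ i, Var[fun ω => Q j (X i ω) * m (X i ω) - α j; P] =
      Var[fun ω => Q j (X 0 ω) * m (X 0 ω); P] := fun i => by
    rw [variance_sub_const (hW i).aestronglyMeasurable]
    exact ((hident i).comp (hQ.mul hm)).variance_eq
  have hsum : Var[∑ i ∈ Finset.range n, fun ω => Q j (X i ω) * m (X i ω) - α j; P] =
      n * Var[fun ω => Q j (X 0 ω) * m (X 0 ω); P] := by
    rw [IndepFun.variance_sum (X := fun i ω => Q j (X i ω) * m (X i ω) - α j) (fun i _ => (hW i).sub (memLp_const _))
      fun i _ l _ hil => (hindep.indepFun hil).comp hu hu]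
    simp [hvar]
  have heq : empCoeff Q m α X n j = fun ω => 1 / √(n : ℝ) *
      (∑ i ∈ Finset.range n, fun ω => Q j (X i ω) * m (X i ω) - α j) ω := by
    funext ω
    simp [empCoeff]
  have hn0 : (n : ℝ) ≠ 0 := by positivity
  rw [heq, variance_const_mul, hsum, div_pow, Real.sq_sqrt (Nat.cast_nonneg n)]
  field_simp

lemma posDef_covMatrix {k : ℕ}
    (hW : ∀ j, 1 ≤ j → ∀ i, MemLp (fun ω => Q j (X i ω) * m (X i ω)) 2 P)
    (hα : ∀ j, 1 ≤ j → ∀ i, ∫ ω, Q j (X i ω) * m (X i ω) ∂P = α j)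
    (hinv : IsUnit (covMatrix P Q m α X n k)) : (covMatrix P Q m α X n k).PosDef :=
  (posSemidef_cov (V := coeffVec Q m α X n k)
    (fun i => memLp_empCoeff (hW _ (Nat.le_add_left 1 i)) n)
    fun i => integral_empCoeff (hW _ (Nat.le_add_left 1 i)) (hα _ (Nat.le_add_left 1 i)) n
    ).posDef_iff_isUnit.2 hinv

/-- Markov's inequality combined with `E T_k = k`. -/
lemma mul_measureReal_testStat_ge_le {k : ℕ}
    (hW : ∀ j, 1 ≤ j → ∀ i, MemLp (fun ω => Q j (X i ω) * m (X i ω)) 2 P)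
    (hα : ∀ j, 1 ≤ j → ∀ i, ∫ ω, Q j (X i ω) * m (X i ω) ∂P = α j)
    (hk : (covMatrix P Q m α X n k).PosDef) (c : ℝ) :
    c * P.real {ω | c ≤ testStat P Q m α X n k ω} ≤ k := by
  have hV : ∀ i, MemLp (fun ω => coeffVec Q m α X n k ω i) 2 P :=
    fun i => memLp_empCoeff (hW _ (Nat.le_add_left 1 i)) n
  have hV0 : ∀ i, ∫ ω, coeffVec Q m α X n k ω i ∂P = 0 := fun i =>
    integral_empCoeff (hW _ (Nat.le_add_left 1 i)) (hα _ (Nat.le_add_left 1 i)) n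
  rw [← integral_norm_invSqrt_mulVec_sq hV hV0 (covMatrix_eq n k) hk]
  exact mul_meas_ge_le_integral_of_nonneg (Eventually.of_forall fun ω => sq_nonneg _)
    (integrable_norm_mulVec_sq hV _) c

/-- The rule selects a dimension other than `1` with probability `O(log N / log n)`. -/
lemma measureReal_schwarzRule_ne_one_le
    (hW : ∀ j, 1 ≤ j → ∀ i, MemLp (fun ω => Q j (X i ω) * m (X i ω)) 2 P)
    (hα : ∀ j, 1 ≤ j → ∀ i, ∫ ω, Q j (X i ω) * m (X i ω) ∂P = α j)
    (hpd : ∀ k, 1 ≤ k → (covMatrix P Q m α X n k).PosDef) (hn : 2 ≤ n) {N : ℕ} (hN : 1 ≤ N) :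
    P.real {ω | schwarzRule (fun k => testStat P Q m α X n k ω) n N ≠ 1} ≤
      Nat.log 2 N * (4 / Real.log n) := by
  have hlog : 0 < Real.log n := Real.log_pos (by exact_mod_cast hn)
  have hsub : {ω | schwarzRule (fun k => testStat P Q m α X n k ω) n N ≠ 1} ⊆
      ⋃ r ∈ Finset.Icc 1 (Nat.log 2 N),
        {ω | (2 : ℝ) ^ r / 2 * Real.log n ≤ testStat P Q m α X n (2 ^ (r + 1)) ω} := by
    intro ω hω
    obtain ⟨r, hr, hle⟩ := exists_le_of_schwarzRule_ne_one hN (testStat_nonneg n 1 ω)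
      (fun k l hk hkl => testStat_mono hkl (hpd k hk) (hpd l (hk.trans hkl)) ω) hω
    exact Set.mem_biUnion hr hle
  refine (measureReal_mono hsub (measure_ne_top _ _)).trans ((measureReal_biUnion_finset_le _ _).trans ?_)
  refine (Finset.sum_le_card_nsmul _ _ (4 / Real.log n) fun r _ => ?_).trans (by simp)
  -- The index `2 ^ (r + 1)` may exceed `N`, which is harmless because positive definiteness holds
  -- in every dimension. The mean `2 ^ (r + 1)` over the threshold gives `4 / log n`, whatever `r`
  -- is.
  have h := mul_measureReal_testStat_ge_le hW hα (hpd (2 ^ (r + 1)) Nat.one_le_two_pow)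
    ((2 : ℝ) ^ r / 2 * Real.log n)
  have h2 : (0 : ℝ) < 2 ^ r := by positivity
  rw [le_div_iff₀ hlog]
  rw [Nat.cast_pow, Nat.cast_ofNat, pow_succ (2 : ℝ)] at h
  refine le_of_mul_le_mul_left (a := (2 : ℝ) ^ r / 2) ?_ (by positivity)
  linarith

/-- For a fixed dimension `1`, the statistic is asymptotically `χ²₁`. -/
lemma tendstoInDistribution_testStat_one (hQ : ∀ j, Measurable (Q j)) (hm : Measurable m)
    (hindep : iIndepFun X P) (hident : ∀ i, IdentDistrib (X i) (X 0) P P)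
    (hW : ∀ i, MemLp (fun ω => Q 1 (X i ω) * m (X i ω)) 2 P)
    (hα : ∀ i, ∫ ω, Q 1 (X i ω) * m (X i ω) ∂P = α 1)
    (hpd : ∀ n, 1 ≤ n → (covMatrix P Q m α X n 1).PosDef) :
    TendstoInDistribution (fun n => testStat P Q m α X n 1) atTop (id : ℝ → ℝ) (fun _ => P)
      (chiSquared 1) := by
  set v := Var[fun ω => Q 1 (X 0 ω) * m (X 0 ω); P] with hv
  have hcov : ∀ n, 1 ≤ n → covMatrix P Q m α X n 1 0 0 = v := fun n hn =>
    (covariance_self (memLp_empCoeff hW n).aestronglyMeasurable.aemeasurable).trans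
      (variance_empCoeff (hQ 1) hm hindep hident hW hn)
  have hvpos : 0 < v := hcov 1 le_rfl ▸ (hpd 1 le_rfl).diag_pos
  have hu : Measurable fun x => (√v)⁻¹ * (Q 1 x * m x - α 1) :=
    (((hQ 1).mul hm).sub_const _).const_mul _
  have hclt := tendstoInDistribution_inv_sqrt_mul_sum (P := P) (P' := gaussianReal 0 1)
    (Y := id) (X := fun i ω => (√v)⁻¹ * (Q 1 (X i ω) * m (X i ω) - α 1)) HasLaw.id
    (by
      rw [integral_const_mul, integral_sub ((hW 0).integrable (by norm_num))
        (integrable_const _), hα]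
      simp)
    (by
      simp only [Pi.pow_apply, mul_pow]
      rw [integral_const_mul, inv_pow, Real.sq_sqrt hvpos.le, ← hα 0,
        ← variance_eq_integral (hW 0).aestronglyMeasurable.aemeasurable, ← hv]
      exact inv_mul_cancel₀ hvpos.ne')
    (hindep.comp _ fun _ => hu) (fun i => (hident i).comp hu)
  have hsq := hclt.continuous_comp (g := fun x : ℝ => x ^ 2) (by fun_prop)
  have heq : ∀ n : ℕ, ((fun x : ℝ => x ^ 2) ∘ fun ω => (√(n : ℝ))⁻¹ * ∑ i ∈ Finset.range n,
      (√v)⁻¹ * (Q 1 (X i ω) * m (X i ω) - α 1)) = testStat P Q m α X n 1 := by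
    intro n
    funext ω
    have hT : testStat P Q m α X n 1 ω =
        (invSqrt (covMatrix P Q m α X n 1) 0 0 * empCoeff Q m α X n 1 ω) ^ 2 := by
      simp [testStat, EuclideanSpace.real_norm_sq_eq, Matrix.mulVec, dotProduct, coeffVec]
    rw [hT]
    -- At `n = 0` positive definiteness is not available, but both sides vanish.
    rcases Nat.eq_zero_or_pos n with rfl | hn
    · simp [empCoeff]
    have hR : invSqrt (covMatrix P Q m α X n 1) 0 0 ^ 2 = v⁻¹ := by
      have h1 := congrFun (congrFun (invSqrt_mul_mul_invSqrt (hpd n hn)) 0) 0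
      simp only [Matrix.mul_apply, Matrix.one_apply_eq, hcov n hn,
        Fin.isValue, Finset.univ_unique, Fin.default_eq_zero, Finset.sum_singleton] at h1
      refine eq_inv_of_mul_eq_one_left (Eq.trans ?_ h1)
      ring
    simp only [Function.comp_apply, empCoeff, ← Finset.mul_sum]
    rw [mul_pow, mul_pow, mul_pow, mul_pow, hR, inv_pow (√v), Real.sq_sqrt hvpos.le]
    ring
  simp only [heq] at hsq
  refine ⟨hsq.forall_aemeasurable, aemeasurable_id, ?_⟩
  convert! hsq.tendsto using 2
  exact congrArg 𝓝 (Subtype.ext (Measure.map_id.trans map_sq_gaussianReal.symm))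

end Sample

end Deconvolution

end

/-! ### Convergence of the data-driven statistic -/

theorem proposition2p1
    -- the reference measure (e.g. Lebesgue or counting measure) and the probability measure `μ`,
    -- which has density `m` with respect to it
    (ν : Measure ℝ) [SigmaFinite ν]
    (μ : Measure ℝ) [IsProbabilityMeasure μ] (m : ℝ → ℝ)
    (hm : Deconvolution.IsDensity μ ν m)
    (Q : ℕ → ℝ → ℝ) (hQ : Deconvolution.IsOrthogonalBasis μ Q)
    -- under `H₀`: independent `Y ~ f₀` and `Z ~ g`, and `Y + Z` has density `h` in `L²(μ)`
    {Ω' : Type*} [MeasurableSpace Ω'] (P' : Measure Ω') [IsProbabilityMeasure P']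
    (Y Z : Ω' → ℝ) (hY : Measurable Y) (hZ : Measurable Z) (hYZ : IndepFun Y Z P')
    (f₀ g h : ℝ → ℝ)
    (hf₀ : Deconvolution.IsDensity (P'.map Y) ν f₀)
    (hg : Deconvolution.IsDensity (P'.map Z) ν g)
    (hh : Deconvolution.IsDensity (P'.map (fun ω => Y ω + Z ω)) ν h)
    (hYμ : P'.map Y ≪ μ) (hXμ : P'.map (fun ω => Y ω + Z ω) ≪ μ)
    (hhL2 : MemLp h 2 μ)
    -- the covariance matrices exist
    (hL2 : ∀ j, 1 ≤ j → MemLp (fun ω => Q j (Y ω + Z ω) * m (Y ω + Z ω)) 2 P')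
    -- the observations: i.i.d. copies of `Y + Z`
    {Ω : Type*} [MeasurableSpace Ω] (P : Measure Ω) [IsProbabilityMeasure P]
    (X : ℕ → Ω → ℝ) (hXindep : iIndepFun X P)
    (hXident : ∀ i, IdentDistrib (X i) (fun ω => Y ω + Z ω) P P')
    (α : ℕ → ℝ) (hα : α = Deconvolution.nullCoeff P' Y Z Q m)
    -- the covariance matrices are invertible
    (hinv : ∀ n k, 1 ≤ n → 1 ≤ k → IsUnit (Deconvolution.covMatrix P Q m α X n k))
    (K : ℕ → ℕ) (hKmono : Monotone K) (hK : Tendsto K atTop atTop)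
    (hlam : (fun n : ℕ => Real.log (K n) /
        Deconvolution.smallestEigenvalue (Deconvolution.covMatrix P Q m α X n (K n)))
      =o[atTop] fun n : ℕ => Real.log n) :
    TendstoInDistribution (fun n => Deconvolution.dataDrivenStat P Q m α X K n) atTop
      (id : ℝ → ℝ) (fun _ => P) (Deconvolution.chiSquared 1) := by
  have hXid : ∀ i, IdentDistrib (X i) (X 0) P P := fun i => (hXident i).trans (hXident 0).symm
  have hid : ∀ j i, IdentDistrib (fun ω => Q j (X i ω) * m (X i ω))
      (fun ω => Q j (Y ω + Z ω) * m (Y ω + Z ω)) P P' := fun j i =>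
    (hXident i).comp ((hQ.measurable j).mul hm.measurable)
  have hW : ∀ j, 1 ≤ j → ∀ i, MemLp (fun ω => Q j (X i ω) * m (X i ω)) 2 P := fun j hj i =>
    (hid j i).memLp_iff.2 (hL2 j hj)
  have hα' : ∀ j, 1 ≤ j → ∀ i, ∫ ω, Q j (X i ω) * m (X i ω) ∂P = α j := fun j _ i =>
    (hid j i).integral_eq.trans (congrFun hα j).symm
  have hpd : ∀ n k, 1 ≤ n → 1 ≤ k → (Deconvolution.covMatrix P Q m α X n k).PosDef :=
    fun n k hn hk => Deconvolution.posDef_covMatrix hW hα' (hinv n k hn hk)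
  set v := Var[fun ω => Q 1 (X 0 ω) * m (X 0 ω); P] with hv
  -- The smallest eigenvalue is at most `v`, which does not depend on `n`, so `log K(n)` is at most
  -- `v` times the ratio in `hlam`.
  have hlogK : (fun n : ℕ => Real.log (K n)) =o[atTop] fun n : ℕ => Real.log n := by
    refine IsBigO.trans_isLittleO (IsBigO.of_bound v ?_) hlam
    filter_upwards [eventually_ge_atTop 1, hK.eventually_ge_atTop 1] with n hn hKn
    have hpos := Deconvolution.smallestEigenvalue_pos (hpd n (K n) hn hKn) hKn
    have hle : Deconvolution.smallestEigenvalue (Deconvolution.covMatrix P Q m α X n (K n)) ≤ v :=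
      (Deconvolution.smallestEigenvalue_le_diag (hpd n (K n) hn hKn) ⟨0, hKn⟩).trans_eq
        ((covariance_self (Deconvolution.memLp_empCoeff (hW 1 le_rfl) n
          ).aestronglyMeasurable.aemeasurable).trans
          (Deconvolution.variance_empCoeff (hQ.measurable 1) hm.measurable hXindep hXid
            (hW 1 le_rfl) hn))
    rw [norm_div, Real.norm_of_nonneg hpos.le, mul_div_assoc', le_div_iff₀ hpos, mul_comm]
    exact mul_le_mul_of_nonneg_right hle (norm_nonneg _)
  have hlim : Tendsto (fun n : ℕ => (Nat.log 2 (K n) : ℝ) * (4 / Real.log n)) atTop (nhds 0) := by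
    have h1 := hlogK.tendsto_div_nhds_zero.const_mul (4 / Real.log 2)
    rw [mul_zero] at h1
    refine squeeze_zero (fun n => ?_) (fun n => ?_) h1
    · have := Real.log_natCast_nonneg n
      positivity
    · have h2 : (Nat.log 2 (K n) : ℝ) ≤ Real.log (K n) / Real.log 2 := by
        simpa [Real.logb] using Real.natLog_le_logb (K n) 2
      refine (mul_le_mul_of_nonneg_right h2
        (div_nonneg (by norm_num) (Real.log_natCast_nonneg n))).trans_eq ?_
      ring
  have hprob : Tendsto (fun n => P {ω | Deconvolution.schwarzRule
      (fun k => Deconvolution.testStat P Q m α X n k ω) n (K n) ≠ 1}) atTop (nhds 0) := by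
    rw [← ENNReal.tendsto_toReal_iff (fun _ => measure_ne_top _ _) ENNReal.zero_ne_top]
    refine squeeze_zero' (Eventually.of_forall fun _ => ENNReal.toReal_nonneg) ?_ hlim
    filter_upwards [eventually_ge_atTop 2, hK.eventually_ge_atTop 1] with n hn hKn
    exact Deconvolution.measureReal_schwarzRule_ne_one_le hW hα'
      (fun k => hpd n k (by omega)) hn hKn
  have hX : ∀ i, AEMeasurable (X i) P := fun i => (hXident i).aemeasurable_fst
  refine tendstoInDistribution_of_tendstoInMeasure_sub _ _
    (Deconvolution.tendstoInDistribution_testStat_one hQ.measurable hm.measurable hXindep hXid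
      (hW 1 le_rfl) (hα' 1 le_rfl) fun n hn => hpd n 1 hn le_rfl) (fun ε hε => ?_)
    (Deconvolution.aemeasurable_dataDrivenStat hQ.measurable hm.measurable hX K)
  -- The data-driven statistic differs from `T_1` only where the rule does not select `1`, so their
  -- difference tends to zero in probability.
  refine tendsto_of_tendsto_of_tendsto_of_le_of_le tendsto_const_nhds hprob (fun _ => zero_le)
    fun n => measure_mono fun ω hω hS => ?_
  have h0 : Deconvolution.dataDrivenStat P Q m α X K n ω =
      Deconvolution.testStat P Q m α X n 1 ω := by
    rw [Deconvolution.dataDrivenStat, hS]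
  simp [h0] at hω
  exact hε.ne' hω
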